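/- Let $q\in L^2([0,1],\mathbb{R})$ and $h_0,h_1,h_2\in\mathbb{R}$ with $h_1\neq h_2$. For $i\in\{1,2\}$ consider the Sturm–Liouville problem $\boldsymbol{q}_i=(h_0,h_i,q)$, $$-u''+qu=\lambda u \text{ on } [0,1],\qquad h_0u(0)+u'(0)=0,\qquad h_iu(1)+u'(1)=0$$ (solutions are real functions $u$ with $u'$ absolutely continuous that satisfy the equation almost everywhere). Let $\lambda_{\boldsymbol{q}_i,0}<\lambda_{\boldsymbol{q}_i,1}<\lambda_{\boldsymbol{q}_i,2}<\cdots$ be its eigenvalues and let $g_{\boldsymbol{q}_i,n}$ be an eigenfunction for $\lambda_{\boldsymbol{q}_i,n}$ with $\|g_{\boldsymbol{q}_i,n}\|_{L^2(0,1)}=1$. The gradient of $\lambda_{\boldsymbol{q}_i,n}$ with respect to $(h_0,h_1,h_2,q)$ is $$\nabla\lambda_{\boldsymbol{q}_i,n}=\bigl(-g_{\boldsymbol{q}_i,n}(0)^2,\ g_{\boldsymbol{q}_i,n}(1)^2\,\delta_{i,1},\ g_{\boldsymbol{q}_i,n}(1)^2\,\delta_{i,2},\ g_{\boldsymbol{q}_i,n}^2\bigr)\in\mathbb{R}^3\times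 L^2(0,1).$$ Then the family $(\nabla\lambda_{\boldsymbol{q}_i,n})_{(i,n)\in\{1,2\}\times\mathbb{N}}$, where $\mathbb{N}=\{0,1,2,\dots\}$, is linearly independent in $\mathbb{R}^3\times L^2(0,1)$, also with respect to convergent infinite combinations: for no $(i,n)$ are there indices $(j_k,m_k)\in\{1,2\}\times\mathbb{N}$ with $(j_k,m_k)\neq(i,n)$ for every $k$, and $a_k\in\mathbb{R}$ $(k\in\mathbb{N})$, such that $$\nabla\lambda_{\boldsymbol{q}_i,n}=\sum_{k=0}^\infty a_k\,\nabla\lambda_{\boldsymbol{q}_{j_k},m_k}$$ with convergence of the partial sums in $\mathbb{R}^3\times L^2(0,1)$. -/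

import Mathlib

open Set MeasureTheory Filter Topology

namespace SturmLiouville

/-- The derivative `u'` of a function on `[0,1]` (one-sided at the endpoints). -/
noncomputable def D (u : ℝ → ℝ) : ℝ → ℝ := derivWithin u (Icc 0 1)

/-- `u` solves `-u'' + q u = lam u` on `[0,1]` for an `L²` potential `q`: `u` is differentiable,
`u'` is absolutely continuous, and the equation holds almost everywhere. -/
structure IsSolution (q : ℝ → ℝ) (lam : ℝ) (u : ℝ → ℝ) : Prop where
  differentiableOn : DifferentiableOn ℝ u (Icc 0 1)
  absolutelyContinuous : AbsolutelyContinuousOnInterval (D u) 0 1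
  equation : ∀ᵐ x ∂volume.restrict (Icc (0 : ℝ) 1), -deriv (D u) x + q x * u x = lam * u x

/-- `u` is an eigenfunction for the eigenvalue `lam` of the Sturm–Liouville problem `(h₀, h, q)`:
a nontrivial solution with `h₀ u(0) + u'(0) = 0` and `h u(1) + u'(1) = 0`. -/
structure IsEigenfunction (h₀ h : ℝ) (q : ℝ → ℝ) (lam : ℝ) (u : ℝ → ℝ) : Prop
    extends IsSolution q lam u where
  left_bc : h₀ * u 0 + D u 0 = 0
  right_bc : h * u 1 + D u 1 = 0
  nontrivial : ∃ x ∈ Icc (0 : ℝ) 1, u x ≠ 0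

/-- The set of eigenvalues of the problem `(h₀, h, q)`. -/
def eigenvalues (h₀ h : ℝ) (q : ℝ → ℝ) : Set ℝ :=
  {lam | ∃ u, IsEigenfunction h₀ h q lam u}

/-- `lam 0 < lam 1 < lam 2 < ⋯` is the list of all eigenvalues of the problem `(h₀, h, q)`,
that is, `lam n` is its `n`-th eigenvalue for every `n`. -/
def IsEigenvalueSequence (h₀ h : ℝ) (q : ℝ → ℝ) (lam : ℕ → ℝ) : Prop :=
  StrictMono lam ∧ range lam = eigenvalues h₀ h q

/-- An eigenfunction of unit norm in `L²(0,1)`. -/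
structure IsNormalizedEigenfunction (h₀ h : ℝ) (q : ℝ → ℝ) (lam : ℝ) (g : ℝ → ℝ) : Prop
    extends IsEigenfunction h₀ h q lam g where
  norm_sq_eq_one : ∫ x in (0 : ℝ)..1, g x ^ 2 = 1

/-- The real Hilbert space `L²(0,1)`. -/
noncomputable abbrev L2 : Type := Lp ℝ 2 (volume.restrict (Icc (0 : ℝ) 1))

theorem IsSolution.memLp_sq {q : ℝ → ℝ} {lam : ℝ} {u : ℝ → ℝ} (hu : IsSolution q lam u) :
    MemLp (fun x => u x ^ 2) 2 (volume.restrict (Icc (0 : ℝ) 1)) := by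
  have hc : ContinuousOn (fun x => u x ^ 2) (Icc (0 : ℝ) 1) := hu.differentiableOn.continuousOn.pow 2
  obtain ⟨C, hC⟩ := isCompact_Icc.exists_bound_of_continuousOn hc
  exact MemLp.of_bound (hc.aestronglyMeasurable measurableSet_Icc) C
    ((ae_restrict_iff' measurableSet_Icc).2 (Eventually.of_forall hC))

/-- The gradient `∇λ = (-g(0)², g(1)² δ_{i,1}, g(1)² δ_{i,2}, g²)` in `ℝ³ × L²(0,1)` of an
eigenvalue of the `i`-th problem, with respect to `(h₀, h₁, h₂, q)`, where `g` is the
corresponding normalized eigenfunction.  The problems `1, 2` are numbered by `0, 1 : Fin 2`. -/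
noncomputable def eigenvalueGradient (i : Fin 2) {h₀ h : ℝ} {q : ℝ → ℝ} {lam : ℝ} {g : ℝ → ℝ}
    (hg : IsNormalizedEigenfunction h₀ h q lam g) : ℝ × ℝ × ℝ × L2 :=
  (-((g 0) ^ 2), if i = 0 then (g 1) ^ 2 else 0, if i = 1 then (g 1) ^ 2 else 0,
    hg.memLp_sq.toLp (fun x => g x ^ 2))

end SturmLiouville

/-!
The family of gradients has a biorthogonal family of continuous linear functionals, and this
excludes both finite and convergent infinite linear relations.

Write `[u, v] = u v' - u' v` for the Wronskian. If `u` solves the equation for `lam`, and `v`, `w`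
solve it for `mu`, then `[u, v]' = (lam - mu) u v`, so

  `([u, v] [u, w] + (lam - mu) u² v w)' = 2 (lam - mu) u² (v w)'`.

Let `v` be an eigenfunction for `mu` of the problem with right boundary constant `h`, and let `w` be
the solution for the same `mu` that satisfies the boundary condition at `1` of the *other* problem,
with constant `h'`: `w(1) = 1`, `w'(1) = -h'`. For an eigenfunction `u` of either problem,
`[u, v](0) = 0` by the common left condition, while at `1` the factor `[u, v]` vanishes if `u`
belongs to the problem of `v`, and `[u, w]` vanishes if `u` belongs to the other one. Integrating, we
get for `lam ≠ mu`

  `2 ∫ u² (v w)' - v(1) w(1) u(1)² + v(0) w(0) u(0)² = 0`.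

The left side is a continuous linear functional of the gradient `(-u(0)², …, u²)`, whichever of the
two middle entries carries `u(1)²`. Its value at the gradient belonging to `v` itself is
`[v, w](1) ∫ v² = (h - h') v(1) ≠ 0`. Moreover different gradients belong to different eigenvalues:
at a common eigenvalue of both problems the eigenfunctions `u`, `v` would have a Wronskian that
is constant, zero at `0`, and a nonzero multiple of `u(1) v(1)` at `1`.

The analytic ingredient is the solvability of the initial value problem at `1` for an integrable
potential (`exists_isSolution`), which also yields the uniqueness behind `v(1) ≠ 0`: the
Wronskians of a solution with a fundamental system determine it. The identities are
`IsSolution.integral_sq_mul` and `IsSolution.integral_sq_mul_self`, the functional is built in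
`exists_dual_functional`.
-/

namespace SturmLiouville

/-! ### The initial value problem with an integrable coefficient -/

theorem intervalIntegral_exp_le {c : ℝ} (hc : 0 < c) (x : ℝ) :
    ∫ s in x..1, Real.exp (c * (1 - s)) ≤ Real.exp (c * (1 - x)) / c := by
  have hderiv : ∀ s ∈ uIcc x 1,
      HasDerivAt (fun s => -(Real.exp (c * (1 - s)) / c)) (Real.exp (c * (1 - s))) s := by
    intro s _
    have h := (((((hasDerivAt_id s).const_sub 1).const_mul c).exp).div_const c).neg
    refine h.congr_deriv ?_
    simp only [id]
    field_simp
  rw [intervalIntegral.integral_eq_sub_of_hasDerivAt hderiv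
    (Continuous.intervalIntegrable (by fun_prop) _ _)]
  simp only [sub_self, mul_zero, Real.exp_zero]
  have : 0 < 1 / c := by positivity
  linarith

/-- For integrable `k` supported in `[0,1]`, the initial value problem `u'' = k u`, `u(1) = a`,
`u'(1) = b` has a solution in integrated form, on all of `ℝ`. It is a fixed point of the Volterra
operator on `C([0,1])`, which is a contraction for the norm `sup |z(t)| exp(-c (1 - t))` when `c` is
large compared with `∫ |k|`. -/
theorem exists_integral_equation {k : ℝ → ℝ} (hk : Integrable k)
    (hk0 : ∀ x ∉ Icc (0 : ℝ) 1, k x = 0) (a b : ℝ) :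
    ∃ u p : ℝ → ℝ, (∀ x, HasDerivAt u (p x) x) ∧ u 1 = a ∧ Integrable (fun t => k t * u t) ∧
      ∀ x, p x = b + ∫ t in (1 : ℝ)..x, k t * u t := by
  set K : ℝ := ∫ t, |k t| with hK
  have hK0 : 0 ≤ K := integral_nonneg fun _ => abs_nonneg _
  set c : ℝ := 2 * K + 1 with hc
  have hc0 : 0 < c := by positivity
  let e : ℝ → ℝ := fun t => Real.exp (c * (1 - t))
  have he : Continuous e := by fun_prop
  -- The contraction acts on `z = u / e`, so that the weighted norm of `u` is the usual norm of `z`.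
  -- `E z` is the corresponding `u`, extended to `ℝ`; it matters only where `k` does not vanish.
  let E : C(Icc (0 : ℝ) 1, ℝ) → ℝ → ℝ := fun z t => e t * z (projIcc 0 1 zero_le_one t)
  have hkE : ∀ z, Integrable fun t => k t * E z t := by
    intro z
    have hEc : Continuous (E z) := he.mul (z.continuous.comp continuous_projIcc)
    obtain ⟨C, hC⟩ := isCompact_Icc.exists_bound_of_continuousOn hEc.continuousOn
    refine Integrable.mono' (hk.norm.const_mul C) (hk.aestronglyMeasurable.mul
      hEc.aestronglyMeasurable) (.of_forall fun t => ?_)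
    by_cases ht : t ∈ Icc (0 : ℝ) 1
    · rw [norm_mul, mul_comm]
      exact mul_le_mul_of_nonneg_right (hC t ht) (norm_nonneg _)
    · simp [hk0 t ht]
  let P : C(Icc (0 : ℝ) 1, ℝ) → ℝ → ℝ := fun z s => b + ∫ t in (1 : ℝ)..s, k t * E z t
  have hP : ∀ z, Continuous (P z) := fun z =>
    continuous_const.add (intervalIntegral.continuous_primitive
      (fun _ _ => (hkE z).intervalIntegrable) 1)
  let U : C(Icc (0 : ℝ) 1, ℝ) → ℝ → ℝ := fun z x => a + ∫ s in (1 : ℝ)..x, P z s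
  have hU : ∀ z x, HasDerivAt (U z) (P z x) x := fun z x =>
    (intervalIntegral.integral_hasDerivAt_right ((hP z).intervalIntegrable _ _)
      ((hP z).stronglyMeasurableAtFilter _ _) (hP z).continuousAt).const_add a
  have hUc : ∀ z, Continuous (U z) := fun z =>
    continuous_iff_continuousAt.2 fun x => (hU z x).continuousAt
  let S : C(Icc (0 : ℝ) 1, ℝ) → C(Icc (0 : ℝ) 1, ℝ) := fun z =>
    ⟨fun x => (e x)⁻¹ * U z x, ((he.inv₀ fun t => (Real.exp_pos _).ne').mul (hUc z)).comp
      continuous_subtype_val⟩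
  -- The inner integral costs a factor `K = ∫ |k|`; the outer one gains `1 / c`.
  have hPd : ∀ z z' : C(Icc (0 : ℝ) 1, ℝ), ∀ s ∈ Icc (0 : ℝ) 1,
      |P z s - P z' s| ≤ K * dist z z' * e s := by
    intro z z' s hs
    have h1 : P z s - P z' s = -∫ t in s..(1 : ℝ), k t * E z t - k t * E z' t := by
      rw [intervalIntegral.integral_sub (hkE z).intervalIntegrable (hkE z').intervalIntegrable,
        intervalIntegral.integral_symm 1 s, intervalIntegral.integral_symm 1 s]
      simp only [P]
      ring
    rw [h1, abs_neg, ← Real.norm_eq_abs]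
    have h2 : ∀ᵐ t, t ∈ Ioc s 1 →
        ‖k t * E z t - k t * E z' t‖ ≤ dist z z' * e s * |k t| := by
      refine .of_forall fun t ht => ?_
      have h3 : k t * E z t - k t * E z' t =
          k t * (e t * (z (projIcc 0 1 zero_le_one t) - z' (projIcc 0 1 zero_le_one t))) := by
        simp only [E]
        ring
      rw [h3, norm_mul, norm_mul, Real.norm_eq_abs, Real.norm_of_nonneg (Real.exp_pos _).le,
        ← dist_eq_norm]
      have h4 : e t ≤ e s := Real.exp_le_exp.2 (by nlinarith [ht.1])
      have h5 := ContinuousMap.dist_apply_le_dist (f := z) (g := z') (projIcc 0 1 zero_le_one t)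
      calc _ ≤ |k t| * (e s * dist z z') := by gcongr
        _ = _ := by ring
    refine (intervalIntegral.norm_integral_le_of_norm_le hs.2 h2
      (hk.abs.const_mul _).intervalIntegrable).trans ?_
    rw [intervalIntegral.integral_const_mul, intervalIntegral.integral_of_le hs.2]
    have h6 : ∫ t in Ioc s 1, |k t| ≤ K :=
      setIntegral_le_integral hk.abs (.of_forall fun _ => abs_nonneg _)
    calc _ ≤ dist z z' * e s * K := by
          have : 0 ≤ e s := (Real.exp_pos _).le
          gcongr
      _ = _ := by ring
  have hS : ContractingWith (1 / 2) S := by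
    refine ⟨by rw [← NNReal.coe_lt_coe]; norm_num, LipschitzWith.of_dist_le_mul fun z z' => ?_⟩
    rw [ContinuousMap.dist_le (by positivity)]
    intro x
    have h1 : U z x - U z' x = -∫ s in (x : ℝ)..1, P z s - P z' s := by
      rw [intervalIntegral.integral_sub ((hP z).intervalIntegrable _ _)
        ((hP z').intervalIntegrable _ _), intervalIntegral.integral_symm 1 (x : ℝ),
        intervalIntegral.integral_symm 1 (x : ℝ)]
      simp only [U]
      ring
    have h2 : |U z x - U z' x| ≤ K * dist z z' * (e x / c) := by
      rw [h1, abs_neg, ← Real.norm_eq_abs]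
      refine (intervalIntegral.norm_integral_le_of_norm_le x.2.2 (.of_forall fun s hs =>
        hPd z z' s ⟨x.2.1.trans hs.1.le, hs.2⟩)
        ((continuous_const.mul he).intervalIntegrable _ _)).trans ?_
      simp only [Pi.mul_apply, intervalIntegral.integral_const_mul]
      exact mul_le_mul_of_nonneg_left (intervalIntegral_exp_le hc0 x) (by positivity)
    have hex : 0 < e x := Real.exp_pos _
    have h3 : K / c ≤ 1 / 2 := by
      rw [div_le_iff₀ hc0]
      linarith
    calc dist (S z x) (S z' x) = (e x)⁻¹ * |U z x - U z' x| := by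
          rw [Real.dist_eq]
          change |(e x)⁻¹ * U z x - (e x)⁻¹ * U z' x| = _
          rw [← mul_sub, abs_mul, abs_of_pos (inv_pos.2 hex)]
      _ ≤ (e x)⁻¹ * (K * dist z z' * (e x / c)) := by gcongr
      _ = K / c * dist z z' := by field_simp
      _ ≤ 1 / 2 * dist z z' := by gcongr
      _ = _ := by norm_num
  let z := hS.fixedPoint
  have hz : S z = z := hS.fixedPoint_isFixedPt
  have hEU : (fun t => k t * E z t) = fun t => k t * U z t := by
    funext t
    by_cases ht : t ∈ Icc (0 : ℝ) 1
    · have h1 : z ⟨t, ht⟩ = (e t)⁻¹ * U z t := by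
        conv_lhs => rw [← hz]
        rfl
      have het : e t ≠ 0 := (Real.exp_pos _).ne'
      simp only [E, projIcc_of_mem zero_le_one ht, h1]
      field_simp
    · simp [hk0 t ht]
  refine ⟨U z, P z, hU z, by simp [U], ?_, fun x => ?_⟩
  · rw [← hEU]
    exact hkE z
  · rw [← hEU]

/-! ### Absolutely continuous functions and solutions -/

theorem absolutelyContinuousOnInterval_congr {f g : ℝ → ℝ} {a b : ℝ}
    (hf : AbsolutelyContinuousOnInterval f a b) (h : EqOn f g (uIcc a b)) :
    AbsolutelyContinuousOnInterval g a b := by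
  rw [absolutelyContinuousOnInterval_iff] at hf ⊢
  intro ε hε
  obtain ⟨δ, hδ, H⟩ := hf ε hε
  refine ⟨δ, hδ, fun E hE hlt => ?_⟩
  refine lt_of_eq_of_lt (Finset.sum_congr rfl fun i hi => ?_) (H E hE hlt)
  rw [h (hE.1 i hi).1, h (hE.1 i hi).2]

theorem integral_eq_sub_of_ae_hasDerivAt {f f' : ℝ → ℝ} {a b : ℝ}
    (hf : AbsolutelyContinuousOnInterval f a b)
    (h : ∀ᵐ x, x ∈ uIcc a b → HasDerivAt f (f' x) x) : ∫ x in a..b, f' x = f b - f a := by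
  rw [← hf.integral_deriv_eq_sub]
  refine intervalIntegral.integral_congr_ae ?_
  filter_upwards [h] with x hx hxm
  exact (hx (uIoc_subset_uIcc hxm)).deriv.symm

theorem ae_mem_Icc_imp_mem_Ioo : ∀ᵐ x : ℝ, x ∈ Icc (0 : ℝ) 1 → x ∈ Ioo (0 : ℝ) 1 := by
  have h (c : ℝ) : ∀ᵐ x : ℝ, x ≠ c := by simp [ae_iff, measure_singleton]
  filter_upwards [h 0, h 1] with x h0 h1 hx
  exact ⟨lt_of_le_of_ne hx.1 h0.symm, lt_of_le_of_ne hx.2 h1⟩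

namespace IsSolution

variable {q : ℝ → ℝ} {lam mu : ℝ} {u v w : ℝ → ℝ}

theorem continuousOn (hu : IsSolution q lam u) : ContinuousOn u (Icc 0 1) :=
  hu.differentiableOn.continuousOn

theorem continuousOn_D (hu : IsSolution q lam u) : ContinuousOn (D u) (Icc 0 1) := by
  simpa [uIcc_of_le] using hu.absolutelyContinuous.continuousOn

theorem absolutelyContinuous_self (hu : IsSolution q lam u) :
    AbsolutelyContinuousOnInterval u 0 1 := by
  refine ContDiffOn.absolutelyContinuousOnInterval ?_
  rw [uIcc_of_le zero_le_one, contDiffOn_one_iff_derivWithin (uniqueDiffOn_Icc zero_lt_one)]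
  exact ⟨hu.differentiableOn, hu.continuousOn_D⟩

theorem hasDerivAt (hu : IsSolution q lam u) {x : ℝ} (hx : x ∈ Ioo (0 : ℝ) 1) :
    HasDerivAt u (D u x) x :=
  (hu.differentiableOn x (Ioo_subset_Icc_self hx)).hasDerivWithinAt.hasDerivAt
    (Icc_mem_nhds hx.1 hx.2)

theorem ae_hasDerivAt (hu : IsSolution q lam u) :
    ∀ᵐ x, x ∈ Icc (0 : ℝ) 1 →
      HasDerivAt u (D u x) x ∧ HasDerivAt (D u) ((q x - lam) * u x) x := by
  have h1 := hu.absolutelyContinuous.ae_differentiableAt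
  rw [uIcc_of_le zero_le_one] at h1
  filter_upwards [h1, (ae_restrict_iff' measurableSet_Icc).1 hu.equation, ae_mem_Icc_imp_mem_Ioo]
    with x hx1 hx2 hx3 hx
  refine ⟨hu.hasDerivAt (hx3 hx), (hx1 hx).hasDerivAt.congr_deriv ?_⟩
  linarith [hx2 hx]

end IsSolution

/-- **Carathéodory existence** at the right endpoint: the equation `-u'' + q u = lam u` has a solution
with any prescribed values of `u(1)` and `u'(1)`. -/
theorem exists_isSolution {q : ℝ → ℝ} (hq : MemLp q 2 (volume.restrict (Icc (0 : ℝ) 1)))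
    (lam a b : ℝ) : ∃ u, IsSolution q lam u ∧ u 1 = a ∧ D u 1 = b := by
  -- `k` is cut off outside `[0,1]`, where nothing is known about `q`.
  let k : ℝ → ℝ := (Icc (0 : ℝ) 1).indicator fun x => q x - lam
  have hk : Integrable k := by
    rw [integrable_indicator_iff measurableSet_Icc]
    exact (hq.integrable one_le_two).sub (integrable_const lam)
  obtain ⟨u, p, hu, hu1, hku, hp⟩ := exists_integral_equation hk
    (fun x hx => indicator_of_notMem hx _) a b
  have hD : EqOn p (D u) (Icc 0 1) := fun x hx =>
    ((hu x).hasDerivWithinAt.derivWithin (uniqueDiffOn_Icc zero_lt_one x hx)).symm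
  refine ⟨u, ⟨fun x _ => (hu x).differentiableAt.differentiableWithinAt, ?_, ?_⟩, hu1, ?_⟩
  · refine absolutelyContinuousOnInterval_congr (f := p) ?_ (by rwa [uIcc_of_le zero_le_one])
    have hc : AbsolutelyContinuousOnInterval (fun _ : ℝ => b) 0 1 :=
      (LipschitzWith.const b).lipschitzOnWith.absolutelyContinuousOnInterval
    rw [funext hp]
    exact hc.fun_add (hku.intervalIntegrable.absolutelyContinuousOnInterval_intervalIntegral
      (by simp))
  · rw [ae_restrict_iff' measurableSet_Icc]
    filter_upwards [_root_.LocallyIntegrable.ae_hasDerivAt_integral hku.locallyIntegrable,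
      ae_mem_Icc_imp_mem_Ioo]
      with x hx hx' hxm
    have h1 : HasDerivAt p (k x * u x) x := by
      rw [funext hp]
      exact (hx 1).const_add b
    have h2 : D u =ᶠ[𝓝 x] p := by
      filter_upwards [Icc_mem_nhds (hx' hxm).1 (hx' hxm).2] with y hy using (hD hy).symm
    have h3 : k x = q x - lam := indicator_of_mem hxm _
    rw [h2.deriv_eq, h1.deriv, h3]
    ring
  · rw [← hD (by simp), hp]
    simp

/-! ### Wronskians and the product identities -/

/-- The Wronskian `u v' - u' v`, with one-sided derivatives at the endpoints of `[0,1]`. -/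
noncomputable def wronskian (u v : ℝ → ℝ) (x : ℝ) : ℝ := u x * D v x - D u x * v x

namespace IsSolution

variable {q : ℝ → ℝ} {lam mu : ℝ} {u v w : ℝ → ℝ}

theorem absolutelyContinuous_wronskian (hu : IsSolution q lam u) (hv : IsSolution q mu v) :
    AbsolutelyContinuousOnInterval (wronskian u v) 0 1 :=
  (hu.absolutelyContinuous_self.fun_mul hv.absolutelyContinuous).fun_sub
    (hu.absolutelyContinuous.fun_mul hv.absolutelyContinuous_self)

theorem ae_hasDerivAt_wronskian (hu : IsSolution q lam u) (hv : IsSolution q mu v) :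
    ∀ᵐ x, x ∈ Icc (0 : ℝ) 1 → HasDerivAt (wronskian u v) ((lam - mu) * (u x * v x)) x := by
  filter_upwards [hu.ae_hasDerivAt, hv.ae_hasDerivAt] with x hx1 hx2 hx
  obtain ⟨h1, h2⟩ := hx1 hx
  obtain ⟨h3, h4⟩ := hx2 hx
  refine ((h1.mul h4).sub (h2.mul h3)).congr_deriv ?_
  ring

theorem wronskian_eq (hu : IsSolution q lam u) (hv : IsSolution q lam v) {x y : ℝ}
    (hx : x ∈ Icc (0 : ℝ) 1) (hy : y ∈ Icc (0 : ℝ) 1) : wronskian u v x = wronskian u v y := by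
  have h := hu.ae_hasDerivAt_wronskian hv
  simp only [sub_self, zero_mul] at h
  rw [← uIcc_of_le zero_le_one] at h hx hy
  obtain ⟨C, hC⟩ := (hu.absolutelyContinuous_wronskian hv).const_of_ae_hasDerivAt_zero h
  rw [hC x hx, hC y hy]

/-- Uniqueness for the initial value problem at `1`. The Wronskians of `u` with two solutions `v`, `w`
are constant, hence zero, and `[v, w] = 1`; Cramer's rule then gives `u = 0`. -/
theorem eq_zero_of_right (hq : MemLp q 2 (volume.restrict (Icc (0 : ℝ) 1)))
    (hu : IsSolution q lam u) (h0 : u 1 = 0) (h1 : D u 1 = 0) : ∀ x ∈ Icc (0 : ℝ) 1, u x = 0 := by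
  intro x hx
  obtain ⟨v, hv, hv0, hv1⟩ := exists_isSolution hq lam 1 0
  obtain ⟨w, hw, hw0, hw1⟩ := exists_isSolution hq lam 0 1
  have h : (1 : ℝ) ∈ Icc (0 : ℝ) 1 := by simp
  have e1 := hu.wronskian_eq hv hx h
  have e2 := hu.wronskian_eq hw hx h
  have e3 := hv.wronskian_eq hw hx h
  simp only [wronskian, h0, h1, hv0, hv1, hw0, hw1] at e1 e2 e3
  linear_combination (-u x) * e3 + v x * e2 - w x * e1

/-- Integrated form of `([u, v] [u, w] + (lam - mu) u² v w)' = 2 (lam - mu) u² (v w)'` for a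
solution `u` for `lam` and solutions `v`, `w` for `mu`. The equation enters only through
`[u, v]' = (lam - mu) u v`, so that `q` drops out. -/
theorem integral_sq_mul (hu : IsSolution q lam u) (hv : IsSolution q mu v)
    (hw : IsSolution q mu w) :
    (lam - mu) * (2 * ∫ x in (0 : ℝ)..1, u x ^ 2 * (D v x * w x + v x * D w x)) =
      (wronskian u v 1 * wronskian u w 1 + (lam - mu) * (u 1 ^ 2 * (v 1 * w 1))) -
      (wronskian u v 0 * wronskian u w 0 + (lam - mu) * (u 0 ^ 2 * (v 0 * w 0))) := by
  let F : ℝ → ℝ := fun x =>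
    wronskian u v x * wronskian u w x + (lam - mu) * (u x ^ 2 * (v x * w x))
  have hF : AbsolutelyContinuousOnInterval F 0 1 := by
    have hu' := hu.absolutelyContinuous_self
    have := ((hu.absolutelyContinuous_wronskian hv).fun_mul
      (hu.absolutelyContinuous_wronskian hw)).fun_add
      (((hu'.fun_mul hu').fun_mul (hv.absolutelyContinuous_self.fun_mul
        hw.absolutelyContinuous_self)).const_mul (lam - mu))
    simpa only [F, pow_two] using this
  have hF' : ∀ᵐ x, x ∈ uIcc (0 : ℝ) 1 → HasDerivAt F
      ((lam - mu) * (2 * (u x ^ 2 * (D v x * w x + v x * D w x)))) x := by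
    rw [uIcc_of_le zero_le_one]
    filter_upwards [hu.ae_hasDerivAt_wronskian hv, hu.ae_hasDerivAt_wronskian hw,
      hu.ae_hasDerivAt, hv.ae_hasDerivAt, hw.ae_hasDerivAt] with x h1 h2 h3 h4 h5 hx
    refine (((h1 hx).mul (h2 hx)).add ((((h3 hx).1.pow 2).mul
      ((h4 hx).1.mul (h5 hx).1)).const_mul (lam - mu))).congr_deriv ?_
    simp only [wronskian, Pi.mul_apply, Pi.pow_apply]
    push_cast
    ring
  rw [← integral_eq_sub_of_ae_hasDerivAt hF hF', intervalIntegral.integral_const_mul,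
    intervalIntegral.integral_const_mul]

/-- The case `u = v` of the product identity, where `lam = mu` and `integral_sq_mul` is void:
`(v² v w)' = 2 v² (v w)' - [v, w] v²`, with a constant Wronskian. -/
theorem integral_sq_mul_self (hv : IsSolution q lam v) (hw : IsSolution q lam w) :
    2 * (∫ x in (0 : ℝ)..1, v x ^ 2 * (D v x * w x + v x * D w x)) =
      v 1 ^ 2 * (v 1 * w 1) - v 0 ^ 2 * (v 0 * w 0) +
        wronskian v w 1 * ∫ x in (0 : ℝ)..1, v x ^ 2 := by
  have hF : AbsolutelyContinuousOnInterval (fun x => v x ^ 2 * (v x * w x)) 0 1 := by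
    have hv' := hv.absolutelyContinuous_self
    simpa only [pow_two] using (hv'.fun_mul hv').fun_mul (hv'.fun_mul hw.absolutelyContinuous_self)
  have hF' : ∀ᵐ x, x ∈ uIcc (0 : ℝ) 1 → HasDerivAt (fun x => v x ^ 2 * (v x * w x))
      (2 * (v x ^ 2 * (D v x * w x + v x * D w x)) - wronskian v w 1 * v x ^ 2) x := by
    rw [uIcc_of_le zero_le_one]
    filter_upwards [hv.ae_hasDerivAt, hw.ae_hasDerivAt] with x h4 h5 hx
    refine (((h4 hx).1.pow 2).mul ((h4 hx).1.mul (h5 hx).1)).congr_deriv ?_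
    rw [← hv.wronskian_eq hw hx (by simp)]
    simp only [wronskian, Pi.mul_apply, Pi.pow_apply]
    push_cast
    ring
  have h := integral_eq_sub_of_ae_hasDerivAt hF hF'
  have hcv := hv.continuousOn
  have hcw := hw.continuousOn
  have hcv' := hv.continuousOn_D
  have hcw' := hw.continuousOn_D
  rw [intervalIntegral.integral_sub, intervalIntegral.integral_const_mul,
    intervalIntegral.integral_const_mul] at h
  · linarith
  · refine ContinuousOn.intervalIntegrable ?_
    rw [uIcc_of_le zero_le_one]
    fun_prop
  · refine ContinuousOn.intervalIntegrable ?_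
    rw [uIcc_of_le zero_le_one]
    fun_prop

end IsSolution

/-! ### The dual functionals -/

theorem memLp_of_continuousOn {f : ℝ → ℝ} (hf : ContinuousOn f (Icc 0 1)) :
    MemLp f 2 (volume.restrict (Icc (0 : ℝ) 1)) := by
  obtain ⟨C, hC⟩ := isCompact_Icc.exists_bound_of_continuousOn hf
  exact MemLp.of_bound (hf.aestronglyMeasurable measurableSet_Icc) C
    ((ae_restrict_iff' measurableSet_Icc).2 (.of_forall hC))

theorem inner_toLp {f g : ℝ → ℝ} (hf : MemLp f 2 (volume.restrict (Icc (0 : ℝ) 1)))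
    (hg : MemLp g 2 (volume.restrict (Icc (0 : ℝ) 1))) :
    inner ℝ (hf.toLp f) (hg.toLp g) = ∫ x in (0 : ℝ)..1, g x * f x := by
  rw [L2.inner_def, intervalIntegral.integral_of_le zero_le_one, ← integral_Icc_eq_integral_Ioc]
  refine integral_congr_ae ?_
  filter_upwards [hf.coeFn_toLp, hg.coeFn_toLp] with x h1 h2
  rw [h1, h2]
  rfl

/-- The continuous linear functional
`(x₀, x₁, x₂, f) ↦ 2 ⟪ρ, f⟫ - α (x₁ + x₂) - β x₀` on `ℝ³ × L²(0,1)`. -/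
noncomputable def functional (ρ : L2) (α β : ℝ) : (ℝ × ℝ × ℝ × L2) →L[ℝ] ℝ :=
  (2 : ℝ) • (innerSL ℝ ρ).comp ((ContinuousLinearMap.snd ℝ ℝ L2).comp
      ((ContinuousLinearMap.snd ℝ ℝ (ℝ × L2)).comp (ContinuousLinearMap.snd ℝ ℝ (ℝ × ℝ × L2)))) -
    α • ((ContinuousLinearMap.fst ℝ ℝ (ℝ × L2)).comp (ContinuousLinearMap.snd ℝ ℝ (ℝ × ℝ × L2)) +
      (ContinuousLinearMap.fst ℝ ℝ L2).comp
        ((ContinuousLinearMap.snd ℝ ℝ (ℝ × L2)).comp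
          (ContinuousLinearMap.snd ℝ ℝ (ℝ × ℝ × L2)))) -
    β • ContinuousLinearMap.fst ℝ ℝ (ℝ × ℝ × L2)

theorem functional_apply (ρ : L2) (α β : ℝ) (x : ℝ × ℝ × ℝ × L2) :
    functional ρ α β x =
      2 * inner ℝ ρ x.2.2.2 - α * (x.2.1 + x.2.2.1) - β * x.1 := by
  simp [functional, mul_add]

/-- The value does not depend on the index `i`, because the two middle entries of the gradient enter
only through their sum `g(1)²`. -/
theorem functional_eigenvalueGradient {f : ℝ → ℝ} (hf : MemLp f 2 (volume.restrict (Icc (0 : ℝ) 1)))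
    (α β : ℝ) (i : Fin 2) {h₀ h : ℝ} {q : ℝ → ℝ} {lam : ℝ} {g : ℝ → ℝ}
    (hg : IsNormalizedEigenfunction h₀ h q lam g) :
    functional (hf.toLp f) α β (eigenvalueGradient i hg) =
      2 * (∫ x in (0 : ℝ)..1, g x ^ 2 * f x) - α * g 1 ^ 2 + β * g 0 ^ 2 := by
  rw [functional_apply]
  have h1 : (eigenvalueGradient i hg).2.2.2 = hg.memLp_sq.toLp (fun x => g x ^ 2) := rfl
  have h2 : (eigenvalueGradient i hg).2.1 + (eigenvalueGradient i hg).2.2.1 = g 1 ^ 2 := by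
    fin_cases i <;> simp [eigenvalueGradient]
  have h3 : (eigenvalueGradient i hg).1 = -(g 0 ^ 2) := rfl
  rw [h1, h2, h3, inner_toLp]
  ring

namespace IsEigenfunction

variable {q : ℝ → ℝ} {h₀ h h' lam mu : ℝ} {u v : ℝ → ℝ}

theorem apply_one_ne_zero (hq : MemLp q 2 (volume.restrict (Icc (0 : ℝ) 1)))
    (hu : IsEigenfunction h₀ h q lam u) : u 1 ≠ 0 := by
  intro h1
  have h2 := hu.right_bc
  rw [h1, mul_zero, zero_add] at h2
  obtain ⟨x, hx, hne⟩ := hu.nontrivial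
  exact hne (hu.toIsSolution.eq_zero_of_right hq h1 h2 x hx)

theorem wronskian_zero (hu : IsEigenfunction h₀ h q lam u) (hv : IsEigenfunction h₀ h' q mu v) :
    wronskian u v 0 = 0 := by
  have h1 := hu.left_bc
  have h2 := hv.left_bc
  simp only [wronskian]
  linear_combination u 0 * h2 - v 0 * h1

/-- Problems with the same left and different right boundary conditions have no common
eigenvalue. -/
theorem eigenvalue_ne (hq : MemLp q 2 (volume.restrict (Icc (0 : ℝ) 1))) (hne : h ≠ h')
    (hu : IsEigenfunction h₀ h q lam u) (hv : IsEigenfunction h₀ h' q mu v) : lam ≠ mu := by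
  rintro rfl
  have h1 := hu.toIsSolution.wronskian_eq hv.toIsSolution (x := 1) (y := 0) (by simp) (by simp)
  rw [hu.wronskian_zero hv, wronskian] at h1
  have h2 := hu.right_bc
  have h3 := hv.right_bc
  have h4 : (h - h') * (u 1 * v 1) = 0 := by
    linear_combination h1 - u 1 * h3 + v 1 * h2
  exact mul_ne_zero (sub_ne_zero.2 hne)
    (mul_ne_zero (hu.apply_one_ne_zero hq) (hv.apply_one_ne_zero hq)) h4

end IsEigenfunction

/-- A functional that is nonzero on the gradient belonging to an eigenfunction `v` of the problem with
right boundary constant `h`, and vanishes on the gradients belonging to all other eigenvalues of this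
problem and of the one with constant `h'`. It pairs `u²` with `(v w)'`, where `w` is the solution
for the eigenvalue of `v` that satisfies the boundary condition at `1` with `h'`. -/
theorem exists_dual_functional {q : ℝ → ℝ} (hq : MemLp q 2 (volume.restrict (Icc (0 : ℝ) 1)))
    {h₀ h h' : ℝ} (hne : h ≠ h') {mu : ℝ} {v : ℝ → ℝ}
    (hv : IsNormalizedEigenfunction h₀ h q mu v) (i : Fin 2) :
    ∃ ℓ : (ℝ × ℝ × ℝ × L2) →L[ℝ] ℝ, ℓ (eigenvalueGradient i hv) ≠ 0 ∧
      ∀ (j : Fin 2) {b lam : ℝ} {u : ℝ → ℝ} (hu : IsNormalizedEigenfunction h₀ b q lam u),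
        b = h ∨ b = h' → lam ≠ mu → ℓ (eigenvalueGradient j hu) = 0 := by
  obtain ⟨w, hw, hw1, hDw1⟩ := exists_isSolution hq mu 1 (-h')
  have hvs := hv.toIsSolution
  have hρ : MemLp (fun x => D v x * w x + v x * D w x) 2 (volume.restrict (Icc (0 : ℝ) 1)) :=
    memLp_of_continuousOn ((hvs.continuousOn_D.mul hw.continuousOn).add
      (hvs.continuousOn.mul hw.continuousOn_D))
  refine ⟨functional (hρ.toLp _) (v 1 * w 1) (v 0 * w 0), ?_, ?_⟩
  · rw [functional_eigenvalueGradient, hvs.integral_sq_mul_self hw, hv.norm_sq_eq_one]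
    have h1 := hv.right_bc
    have h2 : wronskian v w 1 = (h - h') * v 1 := by
      simp only [wronskian, hw1, hDw1]
      linear_combination -h1
    have h3 := mul_ne_zero (sub_ne_zero.2 hne) (hv.apply_one_ne_zero hq)
    rw [h2]
    convert h3 using 1
    ring
  · intro j b lam u hu hb hlam
    rw [functional_eigenvalueGradient]
    have h0 := hu.wronskian_zero hv.toIsEigenfunction
    have h1 : wronskian u v 1 * wronskian u w 1 = 0 := by
      have e1 := hu.right_bc
      have e2 := hv.right_bc
      -- One factor vanishes by the boundary conditions at `1`: for the problem of `v` the first one,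
      -- for the other problem the second one, by the choice of `w`.
      rcases hb with rfl | rfl
      · have : wronskian u v 1 = 0 := by
          simp only [wronskian]
          linear_combination u 1 * e2 - v 1 * e1
        rw [this, zero_mul]
      · have : wronskian u w 1 = 0 := by
          simp only [wronskian, hw1, hDw1]
          linear_combination -e1
        rw [this, mul_zero]
    have key := hu.toIsSolution.integral_sq_mul hvs hw
    rw [h0, h1] at key
    refine mul_left_cancel₀ (sub_ne_zero.2 hlam) ?_
    linear_combination key

/-! ### Linear independence from a biorthogonal family -/

theorem linearIndependent_of_dual {ι E : Type*} [AddCommGroup E] [Module ℝ E]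
    [TopologicalSpace E] {x : ι → E}
    (h : ∀ i, ∃ ℓ : E →L[ℝ] ℝ, ℓ (x i) ≠ 0 ∧ ∀ j ≠ i, ℓ (x j) = 0) :
    LinearIndependent ℝ x := by
  rw [linearIndependent_iff']
  intro s c hc i hi
  obtain ⟨ℓ, h1, h2⟩ := h i
  have h3 := congrArg ℓ hc
  rw [map_sum, map_zero, Finset.sum_eq_single_of_mem i hi fun j _ hj => by
    rw [map_smul, h2 j hj, smul_zero], map_smul] at h3
  exact (smul_eq_zero.1 h3).resolve_right h1

theorem not_tendsto_of_dual {ι E : Type*} [AddCommGroup E] [Module ℝ E]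
    [TopologicalSpace E] {x : ι → E} {i : ι}
    (h : ∃ ℓ : E →L[ℝ] ℝ, ℓ (x i) ≠ 0 ∧ ∀ j ≠ i, ℓ (x j) = 0) (r : ℕ → ι) (a : ℕ → ℝ)
    (hr : ∀ k, r k ≠ i) :
    ¬ Tendsto (fun N => ∑ k ∈ Finset.range N, a k • x (r k)) atTop (𝓝 (x i)) := by
  intro ht
  obtain ⟨ℓ, h1, h2⟩ := h
  have h3 := (ℓ.continuous.tendsto _).comp ht
  have h4 : (ℓ ∘ fun N => ∑ k ∈ Finset.range N, a k • x (r k)) = fun _ => 0 := by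
    funext N
    simp only [Function.comp_apply, map_sum, map_smul]
    exact Finset.sum_eq_zero fun k _ => by rw [h2 _ (hr k), smul_zero]
  rw [h4] at h3
  exact h1 (tendsto_nhds_unique tendsto_const_nhds h3).symm

end SturmLiouville

theorem theorem4p2 (h₀ h₁ h₂ : ℝ) (h_ne : h₁ ≠ h₂) (q : ℝ → ℝ)
    (hq : MemLp q 2 (volume.restrict (Icc (0 : ℝ) 1)))
    (lam : Fin 2 → ℕ → ℝ)
    (hlam : ∀ i, SturmLiouville.IsEigenvalueSequence h₀ (![h₁, h₂] i) q (lam i))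
    (g : Fin 2 → ℕ → ℝ → ℝ)
    (hg : ∀ i n, SturmLiouville.IsNormalizedEigenfunction h₀ (![h₁, h₂] i) q (lam i n) (g i n)) :
    LinearIndependent ℝ
        (fun p : Fin 2 × ℕ => SturmLiouville.eigenvalueGradient p.1 (hg p.1 p.2)) ∧
      ∀ (p : Fin 2 × ℕ) (r : ℕ → Fin 2 × ℕ) (a : ℕ → ℝ), (∀ k, r k ≠ p) →
        ¬ Tendsto
          (fun N => ∑ k ∈ Finset.range N,
            a k • SturmLiouville.eigenvalueGradient (r k).1 (hg (r k).1 (r k).2))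
          atTop (𝓝 (SturmLiouville.eigenvalueGradient p.1 (hg p.1 p.2))) := by
  have hinj : Function.Injective ![h₁, h₂] := by
    intro i j hij
    fin_cases i <;> fin_cases j <;> simp_all
  have hlam_ne : ∀ p p' : Fin 2 × ℕ, p' ≠ p → lam p'.1 p'.2 ≠ lam p.1 p.2 := by
    rintro ⟨i, n⟩ ⟨j, m⟩ hp
    by_cases hij : j = i
    · subst hij
      exact fun he => hp (congrArg (Prod.mk j) ((hlam j).1.injective he))
    · exact (hg j m).toIsEigenfunction.eigenvalue_ne hq (hinj.ne hij) (hg i n).toIsEigenfunction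
  have hdual : ∀ p : Fin 2 × ℕ, ∃ ℓ : (ℝ × ℝ × ℝ × SturmLiouville.L2) →L[ℝ] ℝ,
      ℓ (SturmLiouville.eigenvalueGradient p.1 (hg p.1 p.2)) ≠ 0 ∧
      ∀ p' ≠ p, ℓ (SturmLiouville.eigenvalueGradient p'.1 (hg p'.1 p'.2)) = 0 := by
    intro p
    have hne : ![h₁, h₂] p.1 ≠ ![h₁, h₂] (1 - p.1) := hinj.ne (by
      generalize p.1 = i
      fin_cases i <;> simp)
    obtain ⟨ℓ, h1, h2⟩ := SturmLiouville.exists_dual_functional hq hne (hg p.1 p.2) p.1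
    refine ⟨ℓ, h1, fun p' hp' => h2 p'.1 (hg p'.1 p'.2) ?_ (hlam_ne p p' hp')⟩
    have hor : ∀ i j : Fin 2, j = i ∨ j = 1 - i := by decide
    exact (hor p.1 p'.1).imp (congrArg _) (congrArg _)
  refine ⟨?_, ?_⟩
  · exact SturmLiouville.linearIndependent_of_dual hdual
  · intro p r a hr
    exact SturmLiouville.not_tendsto_of_dual
      (x := fun p : Fin 2 × ℕ => SturmLiouville.eigenvalueGradient p.1 (hg p.1 p.2))
      (hdual p) r a hr
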